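/- Let $K\ge 2$. Let $f:\mathbb R^K\to[0,\infty)$ be a probability density with respect to Lebesgue measure that is invariant under permutations of the coordinates. Let $\mathcal X_K$ be the set of pairs $(v,\Sigma)\in\mathbb R^K\times\mathbb R^{K\times K}$ with $\sum_k v_k=0$, $\Sigma$ symmetric positive semidefinite, $\Sigma\mathbf 1=0$ and $\operatorname{tr}\Sigma=K$. With $\Sigma^{1/2}$ the symmetric positive semidefinite square root, the choice probabilities are $$P_j(v,\Sigma)=\int_{\mathcal R_j(v,\Sigma)} f(e)\,de,\qquad \mathcal R_j(v,\Sigma)=\{e: v_j+(\Sigma^{1/2}e)_j\ge v_k+(\Sigma^{1/2}e)_k\ \text{for all } k\ne j\}.$$ Let $\mathcal B_j$ be the set of $(v,\Sigma)\in\mathcal X_K$ for which at least one of the following fails: (a) the triples $(v_k,\Sigma_{kk},\Sigma_{jk})$, $k\neq j$, are pairwise distinct, and the entries $\Sigma_{kl}$ with $k<l$, $k,l\ne j$, are pairwise distinct; (b) for each $k\ne j$ there is exactly one set $S$ of $K-2$ positions $(m,l)$ with $m<l$ and $m,l\neq j$ such that $\sum_{(m,l)\in S}\Sigma_{ml}=-\Sigma_{kk}-\Sigma_{jk}$.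 Let $\mathcal T_j$ be the set of $(v,\Sigma)$ at which $j$ ties with certainty with some other alternative, that is, $v_j=v_k$ and $\Sigma_{jj}+\Sigma_{kk}-2\Sigma_{jk}=0$ for some $k\ne j$. Fix an infinitely differentiable activation function $\sigma:\mathbb R\to\mathbb R$ that is not a polynomial. A multi-layer perceptron (MLP) is a composition of finitely many (possibly zero) hidden layers $x\mapsto\sigma(Wx+b)$, $\sigma$ acting entrywise, of arbitrary widths, followed by an affine output layer. A per-alternative encoder with output dimension $d$ consists of MLPs $\phi_{\rm diag},\rho_{\rm diag},\phi_{\rm off},\rho_{\rm off},\zeta$ and computes $$z_j=\zeta\Big(\rho_{\rm diag}\Big(\sum_{k\ne j}\phi_{\rm diag}(d_{jk})\Big),\ \rho_{\rm off}\Big(\sum_{k<l;\ k,l\ne j}\phi_{\rm off}(o_{kl})\Big),\ s_j\Big)\in\mathbb R^{d},$$ where $d_{jk}$ consists of $v_j,v_k,\Sigma_{jj},\Sigma_{kk},\Sigma_{jk}$ and any fixed finite number (possibly zero) of functions of these, $o_{kl}$ consists of $\Sigma_{kl}$ and any fixed finite number (possibly zero) of functions of $(v_k,v_l,\Sigma_{kk},\Sigma_{ll},\Sigma_{kl})$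 that are symmetric in $k,l$, and $s_j$ is a fixed, possibly empty, permutation-equivariant vector of pass-through features of alternative $j$. The full architecture stacks $z_1,\dots,z_K$ (computed with the same encoder weights) as the rows of a matrix $Z$, applies one or more layers $L(Z)=\sigma\big(ZA+\tfrac1K\mathbf 1\mathbf 1^\top ZB+\mathbf 1c^\top\big)$ of arbitrary widths, multiplies the result by a vector $a$ to obtain one logit per alternative, and outputs $\hat P_j=\exp(\mathrm{logit}_j)/\sum_k\exp(\mathrm{logit}_k)$. Then, for every choice of the additional features: 1. For every $j$, every compact $C\subset\mathcal X_K\setminus(\mathcal B_j\cup\mathcal T_j)$ and every $\varepsilon>0$ there is a per-alternative encoder with output dimension $1$ such that $|z_j(v,\Sigma)-P_j(v,\Sigma)|<\varepsilon$ for all $(v,\Sigma)\in C$. 2. For every compact $C\subset\mathcal X_K\setminus\bigcup_{j}\mathcal B_j$ and every $\varepsilon>0$ there is a network of the full architecture such that $|\hat P_j(v,\Sigma)-P_j(v,\Sigma)|<\varepsilon$ for all $j$ and all $(v,\Sigma)\in C$. -/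

import Mathlib

/-- A choice problem with `K` alternatives: deterministic utilities and a scale matrix. -/
abbrev ChoiceInput (K : ℕ) : Type := (Fin K → ℝ) × Matrix (Fin K) (Fin K) ℝ

/-- `f` is a Lebesgue density on `ℝ^K` that is invariant under permutations of the coordinates. -/
structure IsExchangeableDensity {K : ℕ} (f : (Fin K → ℝ) → ℝ) : Prop where
  measurable : Measurable f
  nonneg : ∀ e, 0 ≤ f e
  integrable : MeasureTheory.Integrable f
  integral_eq_one : ∫ e, f e = 1
  exchangeable : ∀ (π : Equiv.Perm (Fin K)) (e : Fin K → ℝ), f (e ∘ π) = f e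

open scoped MatrixOrder in
/-- The symmetric positive semidefinite square root of a positive semidefinite matrix. -/
noncomputable def scaleSqrt {K : ℕ} (S : Matrix (Fin K) (Fin K) ℝ) :
    Matrix (Fin K) (Fin K) ℝ :=
  CFC.sqrt S

/-- The set of error vectors `e` for which alternative `j` maximizes the utilities
`U_k = v_k + (Σ^{1/2} e)_k`. -/
def choiceRegion {K : ℕ} (j : Fin K) (x : ChoiceInput K) : Set (Fin K → ℝ) :=
  {e | ∀ k, k ≠ j →
    x.1 k + (scaleSqrt x.2).mulVec e k ≤ x.1 j + (scaleSqrt x.2).mulVec e j}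

/-- The probability `P_j(v, Σ)` that alternative `j` is chosen. -/
noncomputable def choiceProb {K : ℕ} (f : (Fin K → ℝ) → ℝ) (j : Fin K) (x : ChoiceInput K) : ℝ :=
  ∫ e in choiceRegion j x, f e

/-- The space of centered and scale-normalized inputs. -/
def inputSpace (K : ℕ) : Set (ChoiceInput K) :=
  {x | ∑ k, x.1 k = 0 ∧ x.2.mulVec (fun _ => 1) = 0 ∧ x.2.trace = K ∧ x.2.PosSemidef}

/-- The above-diagonal positions `(k, l)`, `k < l`, of the matrix without row and column `j`. -/
def offPositions {K : ℕ} (j : Fin K) : Finset (Fin K × Fin K) :=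
  Finset.univ.filter fun p => p.1 < p.2 ∧ p.1 ≠ j ∧ p.2 ≠ j

/-- The triples `(v_k, Σ_kk, Σ_jk)`, `k ≠ j`, are pairwise distinct, and so are the off-diagonal
entries of the matrix without row and column `j`. -/
def DistinctAt {K : ℕ} (j : Fin K) (x : ChoiceInput K) : Prop :=
  Set.InjOn (fun k => (x.1 k, x.2 k k, x.2 j k)) {k | k ≠ j} ∧
  Set.InjOn (fun p : Fin K × Fin K => x.2 p.1 p.2) (offPositions j : Set (Fin K × Fin K))

/-- For each `k ≠ j`, exactly one set of `K - 2` off-diagonal positions avoiding `j` has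
entries adding up to `-Σ_kk - Σ_jk`. -/
def UniqueSumsAt {K : ℕ} (j : Fin K) (x : ChoiceInput K) : Prop :=
  ∀ k, k ≠ j → ∃! S : Finset (Fin K × Fin K),
    S ∈ (offPositions j).powersetCard (K - 2) ∧ ∑ p ∈ S, x.2 p.1 p.2 = -x.2 k k - x.2 j k

/-- The exceptional set `B_j`. -/
def exceptionalSet {K : ℕ} (j : Fin K) : Set (ChoiceInput K) :=
  {x | x ∈ inputSpace K ∧ ¬ (DistinctAt j x ∧ UniqueSumsAt j x)}

/-- Inputs at which alternative `j` ties with another alternative for every error vector: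
the deterministic utilities agree, and `Σ_jj + Σ_kk - 2 Σ_jk`, the squared length of the difference
of the rows `j` and `k` of `Σ^{1/2}`, vanishes. -/
def certainTieSet {K : ℕ} (j : Fin K) : Set (ChoiceInput K) :=
  {x | ∃ k, k ≠ j ∧ x.1 j = x.1 k ∧ x.2 j j + x.2 k k - 2 * x.2 j k = 0}

/-- Weights of a multi-layer perceptron from `ℝ^m` to `ℝ^n`: finitely many hidden layers
of arbitrary widths, followed by an affine output layer. -/
inductive MLP : ℕ → ℕ → Type
  | output {m n : ℕ} (W : Matrix (Fin n) (Fin m) ℝ) (b : Fin n → ℝ) : MLP m n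
  | hidden {m h n : ℕ} (W : Matrix (Fin h) (Fin m) ℝ) (b : Fin h → ℝ) (rest : MLP h n) : MLP m n

/-- The function computed by a multi-layer perceptron with activation function `σ`. -/
def MLP.eval (σ : ℝ → ℝ) : {m n : ℕ} → MLP m n → (Fin m → ℝ) → (Fin n → ℝ)
  | _, _, .output W b, x => W.mulVec x + b
  | _, _, .hidden W b rest, x => rest.eval σ fun i => σ ((W.mulVec x + b) i)

/-- A choice of features that are fed to the encoder in addition to the base inputs; there may
be none (all dimensions `0`). -/
structure ExtraFeatures (K : ℕ) where
  /-- number of additional features of a pair `(j, k)` -/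
  dDiag : ℕ
  /-- number of additional features of an unordered pair `{k, l}` -/
  dOff : ℕ
  /-- number of pass-through features -/
  dPass : ℕ
  /-- additional features as functions of `v_j, v_k, Σ_jj, Σ_kk, Σ_jk` -/
  diag : ℝ → ℝ → ℝ → ℝ → ℝ → Fin dDiag → ℝ
  /-- additional features as functions of `v_k, v_l, Σ_kk, Σ_ll, Σ_kl` -/
  off : ℝ → ℝ → ℝ → ℝ → ℝ → Fin dOff → ℝ
  /-- pass-through features of alternative `j` -/
  pass : Fin K → ChoiceInput K → Fin dPass → ℝ
  off_symm : ∀ u u' s s' c, off u u' s s' c = off u' u s' s c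
  pass_equivariant : ∀ (π : Equiv.Perm (Fin K)) (j : Fin K) (x : ChoiceInput K),
    pass j (x.1 ∘ π, x.2.submatrix π π) = pass (π j) x

/-- The input of the diagonal DeepSet for the pair `(j, k)`. -/
def ExtraFeatures.diagInput {K : ℕ} (F : ExtraFeatures K) (x : ChoiceInput K) (j k : Fin K) :
    Fin (5 + F.dDiag) → ℝ :=
  Fin.append ![x.1 j, x.1 k, x.2 j j, x.2 k k, x.2 j k]
    (F.diag (x.1 j) (x.1 k) (x.2 j j) (x.2 k k) (x.2 j k))

/-- The input of the off-diagonal DeepSet for the pair `{k, l}`. -/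
def ExtraFeatures.offInput {K : ℕ} (F : ExtraFeatures K) (x : ChoiceInput K) (k l : Fin K) :
    Fin (1 + F.dOff) → ℝ :=
  Fin.append ![x.2 k l] (F.off (x.1 k) (x.1 l) (x.2 k k) (x.2 l l) (x.2 k l))

/-- Weights of a per-alternative encoder with output dimension `d`. -/
structure Encoder {K : ℕ} (F : ExtraFeatures K) (d : ℕ) where
  /-- width of the sum in the diagonal DeepSet -/
  mDiag : ℕ
  /-- output dimension of the diagonal DeepSet -/
  nDiag : ℕ
  /-- width of the sum in the off-diagonal DeepSet -/
  mOff : ℕ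
  /-- output dimension of the off-diagonal DeepSet -/
  nOff : ℕ
  phiDiag : MLP (5 + F.dDiag) mDiag
  rhoDiag : MLP mDiag nDiag
  phiOff : MLP (1 + F.dOff) mOff
  rhoOff : MLP mOff nOff
  zeta : MLP (nDiag + nOff + F.dPass) d

/-- Output of the diagonal DeepSet for alternative `j`. -/
def Encoder.hDiag {K d : ℕ} {F : ExtraFeatures K} (E : Encoder F d) (σ : ℝ → ℝ)
    (j : Fin K) (x : ChoiceInput K) : Fin E.nDiag → ℝ :=
  E.rhoDiag.eval σ (∑ k ∈ Finset.univ.filter (fun k => k ≠ j), E.phiDiag.eval σ (F.diagInput x j k))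

/-- Output of the off-diagonal DeepSet for alternative `j`. -/
def Encoder.hOff {K d : ℕ} {F : ExtraFeatures K} (E : Encoder F d) (σ : ℝ → ℝ)
    (j : Fin K) (x : ChoiceInput K) : Fin E.nOff → ℝ :=
  E.rhoOff.eval σ (∑ p ∈ offPositions j, E.phiOff.eval σ (F.offInput x p.1 p.2))

/-- The representation `z_j` of alternative `j`. -/
def Encoder.eval {K d : ℕ} {F : ExtraFeatures K} (E : Encoder F d) (σ : ℝ → ℝ)
    (j : Fin K) (x : ChoiceInput K) : Fin d → ℝ :=
  E.zeta.eval σ (Fin.append (Fin.append (E.hDiag σ j x) (E.hOff σ j x)) (F.pass j x))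

/-- Weights of a permutation-equivariant layer. -/
structure EquivariantLayer (m n : ℕ) where
  A : Matrix (Fin m) (Fin n) ℝ
  B : Matrix (Fin m) (Fin n) ℝ
  c : Fin n → ℝ

/-- `L(Z) = σ(Z A + K⁻¹ 1 1ᵀ Z B + 1 cᵀ)`, with `σ` applied entrywise. -/
noncomputable def EquivariantLayer.eval {K m n : ℕ} (L : EquivariantLayer m n) (σ : ℝ → ℝ)
    (Z : Matrix (Fin K) (Fin m) ℝ) : Matrix (Fin K) (Fin n) ℝ :=
  Matrix.of fun k i => σ ((Z * L.A) k i + (1 / (K : ℝ)) * ∑ l, (Z * L.B) l i + L.c i)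

/-- One or more consecutive equivariant layers. -/
inductive EquivariantStack : ℕ → ℕ → Type
  | single {m n : ℕ} (L : EquivariantLayer m n) : EquivariantStack m n
  | cons {m h n : ℕ} (L : EquivariantLayer m h) (rest : EquivariantStack h n) :
      EquivariantStack m n

/-- The map computed by consecutive equivariant layers. -/
noncomputable def EquivariantStack.eval {K : ℕ} (σ : ℝ → ℝ) : {m n : ℕ} →
    EquivariantStack m n → Matrix (Fin K) (Fin m) ℝ → Matrix (Fin K) (Fin n) ℝ
  | _, _, .single L, Z => L.eval σ Z
  | _, _, .cons L rest, Z => rest.eval σ (L.eval σ Z)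

/-- Weights of the full architecture. -/
structure Network {K : ℕ} (F : ExtraFeatures K) where
  dz : ℕ
  dL : ℕ
  encoder : Encoder F dz
  layers : EquivariantStack dz dL
  a : Fin dL → ℝ

/-- The logits `Z^{(L)} a`. -/
noncomputable def Network.logit {K : ℕ} {F : ExtraFeatures K} (N : Network F) (σ : ℝ → ℝ)
    (x : ChoiceInput K) : Fin K → ℝ :=
  (N.layers.eval σ (Matrix.of fun j => N.encoder.eval σ j x)).mulVec N.a

/-- The emulated choice probabilities, the softmax of the logits. -/
noncomputable def Network.prob {K : ℕ} {F : ExtraFeatures K} (N : Network F) (σ : ℝ → ℝ)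
    (x : ChoiceInput K) (j : Fin K) : ℝ :=
  Real.exp (N.logit σ x j) / ∑ k, Real.exp (N.logit σ x k)

/-!
The derivatives at `s = 0` of `s ↦ σ (s u + b)` are `u ^ k * σ⁽ᵏ⁾(b)`, and no `σ⁽ᵏ⁾` vanishes
identically, so the closed span of the ridge functions `σ (u + b)`, with `u` in a linear space,
contains all powers `u ^ k`, hence all `exp u`. By the Stone–Weierstrass theorem it contains every
continuous function that factors through the values of the `u`. On a finite set the networks
with one hidden layer are therefore all functions, hence the sums of such networks over a multiset
determine the multiset, and an encoder can approximate every continuous function of the two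
multisets that it sees.

These multisets determine `(v, Σ)` up to a relabelling of the alternatives. As the rows of `Σ` sum
to zero, the entries of row `k` outside the columns `j` and `k` sum to `-Σ_kk - Σ_jk`, and by the
uniqueness in (b) this recognizes their positions; the entry `Σ_kl` sits at the common position of
the rows `k` and `l`. Since `f` is exchangeable, relabelling carries `P_j` along, and `P_j` is
continuous where `j` has no certain tie. For the full architecture, the logits approximate
`log (P_j + δ)`, where `δ > 0` allows for vanishing probabilities.
-/

/-! ### Ridge functions of a smooth non-polynomial activation -/

theorem exists_polynomial_of_iteratedDeriv_eq_zero {k : ℕ} {g : ℝ → ℝ} (hg : ContDiff ℝ k g)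
    (h : ∀ t, iteratedDeriv k g t = 0) : ∃ p : Polynomial ℝ, ∀ t, g t = p.eval t := by
  obtain _ | k := k
  · exact ⟨0, by simpa using h⟩
  let p : Polynomial ℝ := ∑ i ∈ Finset.range (k + 1),
    Polynomial.C ((i.factorial : ℝ)⁻¹ * iteratedDeriv i g 0) * Polynomial.X ^ i
  refine ⟨p, fun t => ?_⟩
  obtain rfl | ht := eq_or_ne 0 t
  · simp [p, Polynomial.eval_finsetSum, Finset.sum_range_succ']
  obtain ⟨s, -, hs⟩ := taylor_mean_remainder_lagrange_iteratedDeriv ht hg.contDiffOn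
  rw [h s, zero_mul, zero_div, sub_eq_zero, taylor_within_apply] at hs
  simp only [hs, p, Polynomial.eval_finsetSum, Polynomial.eval_mul, Polynomial.eval_C,
    Polynomial.eval_pow, Polynomial.eval_X, sub_zero, smul_eq_mul]
  refine Finset.sum_congr rfl fun i hi => ?_
  have hgi : ContDiffAt ℝ i g 0 :=
    (hg.of_le (mod_cast (Finset.mem_range.1 hi).le)).contDiffAt
  rw [iteratedDerivWithin_eq_iteratedDeriv (uniqueDiffOn_uIcc ht) hgi Set.left_mem_uIcc]
  ring

section Ridge

variable {D : Type*} [TopologicalSpace D] {V : Type*} [AddCommGroup V] [Module ℝ V]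

/-- The linear span of the ridge functions `x ↦ σ (L v x + b)` over a linear family `L` of
continuous functions; for an affine family on `ℝ^m` these are the neural networks with one hidden
layer. -/
def ridgeSpan (σ : C(ℝ, ℝ)) (L : V →ₗ[ℝ] C(D, ℝ)) : Submodule ℝ C(D, ℝ) :=
  Submodule.span ℝ (Set.range fun q : V × ℝ => σ.comp (L q.1 + ContinuousMap.const D q.2))

theorem exists_eq_sum_of_mem_ridgeSpan {σ : C(ℝ, ℝ)} {L : V →ₗ[ℝ] C(D, ℝ)} {u : C(D, ℝ)}
    (hu : u ∈ ridgeSpan σ L) :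
    ∃ (n : ℕ) (v : Fin n → V) (a b : Fin n → ℝ), ∀ x, u x = ∑ i, a i * σ (L (v i) x + b i) := by
  obtain ⟨n, a, w, rfl⟩ := Submodule.mem_span_set'.1 hu
  choose q hq using fun i => (w i).2
  refine ⟨n, fun i => (q i).1, a, fun i => (q i).2, fun x => ?_⟩
  simp [← hq, ContinuousMap.sum_apply]

variable [CompactSpace D]

/- Integrating the claimed derivative avoids estimating difference quotients uniformly on `D`. -/
theorem hasDerivAt_comp_smul_add {g g' : C(ℝ, ℝ)} (hg : ∀ t, HasDerivAt g (g' t) t)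
    (h u : C(D, ℝ)) (t : ℝ) :
    HasDerivAt (fun s : ℝ => g.comp (s • h + u)) (h * g'.comp (t • h + u)) t := by
  let F : ℝ → C(D, ℝ) := fun s => h * g'.comp (s • h + u)
  have hF : Continuous F :=
    continuous_const.mul ((ContinuousMap.continuous_postcomp g').comp (by fun_prop))
  have hint : (fun s => g.comp (s • h + u)) = fun s => (∫ r in (0 : ℝ)..s, F r) + g.comp u := by
    ext s x
    have hderiv (r : ℝ) : HasDerivAt (fun r => g (r * h x + u x)) (F r x) r := by
      have := (hg (r * h x + u x)).comp r (((hasDerivAt_id r).mul_const (h x)).add_const (u x))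
      simpa [F, mul_comm, Function.comp_def] using this
    have hftc : ∫ r in (0 : ℝ)..s, F r x = g (s * h x + u x) - g (0 * h x + u x) :=
      intervalIntegral.integral_eq_sub_of_hasDerivAt (fun r _ => hderiv r)
        (((continuous_eval_const x).comp hF).intervalIntegrable _ _)
    have heval := (ContinuousMap.evalCLM ℝ x).intervalIntegral_comp_comm
      (hF.intervalIntegrable (μ := MeasureTheory.volume) 0 s)
    simp only [ContinuousMap.evalCLM_apply] at heval
    simp [← heval, hftc]
  rw [hint]
  exact (hF.integral_hasStrictDerivAt 0 t).hasDerivAt.add_const _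

theorem mem_topologicalClosure_of_hasDerivAt {E : Type*} [NormedAddCommGroup E] [NormedSpace ℝ E]
    {W : Submodule ℝ E} {γ : ℝ → E} {γ' : E} {t : ℝ} (hγ : ∀ s, γ s ∈ W.topologicalClosure)
    (h : HasDerivAt γ γ' t) : γ' ∈ W.topologicalClosure := by
  have hspan : Submodule.span ℝ (γ '' Set.univ) ≤ W.topologicalClosure :=
    Submodule.span_le.2 (by rintro _ ⟨s, -, rfl⟩; exact hγ s)
  refine closure_minimal hspan W.isClosed_topologicalClosure ?_
  exact range_deriv_subset_closure_span_image γ dense_univ ⟨t, h.deriv⟩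

theorem pow_mul_comp_mem_closure_ridgeSpan {g : ℕ → C(ℝ, ℝ)}
    (hg : ∀ k t, HasDerivAt (g k) (g (k + 1) t) t) (L : V →ₗ[ℝ] C(D, ℝ)) (v : V) (b : ℝ) (k : ℕ) :
    ∀ s : ℝ, L v ^ k * (g k).comp (s • L v + ContinuousMap.const D b) ∈
      (ridgeSpan (g 0) L).topologicalClosure := by
  induction k with
  | zero =>
    refine fun s => Submodule.le_topologicalClosure _ (Submodule.subset_span ⟨(s • v, b), ?_⟩)
    simp
  | succ k ih =>
    intro s
    rw [pow_succ, mul_assoc]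
    exact mem_topologicalClosure_of_hasDerivAt ih
      ((hasDerivAt_comp_smul_add (hg k) (L v) (ContinuousMap.const D b) s).const_mul (L v ^ k))

variable {σ : C(ℝ, ℝ)} (hσ : ContDiff ℝ (⊤ : ℕ∞) σ)
  (hσ_nonpoly : ¬ ∃ p : Polynomial ℝ, ∀ t, σ t = p.eval t)

include hσ hσ_nonpoly

/- `L v ^ k * σ⁽ᵏ⁾(b)` is the `k`-th derivative at `s = 0` of the curve `s ↦ σ (s L v + b)`. -/
theorem pow_mem_closure_ridgeSpan (L : V →ₗ[ℝ] C(D, ℝ)) (v : V) (k : ℕ) :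
    L v ^ k ∈ (ridgeSpan σ L).topologicalClosure := by
  have hsmooth (k : ℕ) : ContDiff ℝ k σ := hσ.of_le (mod_cast le_top)
  obtain ⟨b, hb⟩ : ∃ b, iteratedDeriv k σ b ≠ 0 := by
    by_contra! hzero
    exact hσ_nonpoly (exists_polynomial_of_iteratedDeriv_eq_zero (hsmooth k) hzero)
  let g : ℕ → C(ℝ, ℝ) := fun k => ⟨iteratedDeriv k σ, (hsmooth k).continuous_iteratedDeriv k le_rfl⟩
  have hg (k : ℕ) (t : ℝ) : HasDerivAt (g k) (g (k + 1) t) t := by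
    simpa [g, iteratedDeriv_succ] using
      ((hsmooth (k + 1)).differentiable_iteratedDeriv k (by norm_cast; simp) t).hasDerivAt
  have hg₀ : g 0 = σ := by ext; simp [g]
  have hmem := pow_mul_comp_mem_closure_ridgeSpan hg L v b k 0
  rw [hg₀] at hmem
  convert Submodule.smul_mem _ (iteratedDeriv k σ b)⁻¹ hmem using 1
  ext x
  simp [g, mul_comm, hb]

theorem exp_mem_closure_ridgeSpan (L : V →ₗ[ℝ] C(D, ℝ)) (v : V) :
    NormedSpace.exp (L v) ∈ (ridgeSpan σ L).topologicalClosure :=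
  (Submodule.isClosed_topologicalClosure _).mem_of_tendsto
    (NormedSpace.exp_series_hasSum_exp' (𝕂 := ℝ) (L v)) <| .of_forall fun _ =>
      Submodule.sum_mem _ fun k _ =>
        Submodule.smul_mem _ _ (pow_mem_closure_ridgeSpan hσ hσ_nonpoly L v k)

theorem closure_ridgeSpan_eq_top {L : V →ₗ[ℝ] C(D, ℝ)}
    (hsep : ∀ x y : D, (∀ v, L v x = L v y) → x = y) :
    (ridgeSpan σ L).topologicalClosure = ⊤ := by
  let M : Submonoid C(D, ℝ) :=
    { carrier := Set.range fun v => NormedSpace.exp (L v)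
      one_mem' := ⟨0, by simp⟩
      mul_mem' := by
        rintro _ _ ⟨v, rfl⟩ ⟨w, rfl⟩
        exact ⟨v + w, by simp [NormedSpace.exp_add]⟩ }
  have hle : Subalgebra.toSubmodule (Algebra.adjoin ℝ (M : Set C(D, ℝ))) ≤
      (ridgeSpan σ L).topologicalClosure := by
    rw [Algebra.adjoin_eq_span, Submonoid.closure_eq, Submodule.span_le]
    rintro _ ⟨v, rfl⟩
    exact exp_mem_closure_ridgeSpan hσ hσ_nonpoly L v
  have htop := ContinuousMap.subalgebra_topologicalClosure_eq_top_of_separatesPoints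
    (Algebra.adjoin ℝ (M : Set C(D, ℝ))) (by
      intro x y hxy
      obtain ⟨v, hv⟩ : ∃ v, L v x ≠ L v y := by
        by_contra! hL
        exact hxy (hsep x y hL)
      refine ⟨_, ⟨NormedSpace.exp (L v), Algebra.subset_adjoin ⟨v, rfl⟩, rfl⟩, ?_⟩
      simpa [NormedSpace.exp_continuousMap_eq, ← Real.exp_eq_exp_ℝ] using hv)
  refine eq_top_iff.2 fun u _ => ?_
  have hu : u ∈ (Algebra.adjoin ℝ (M : Set C(D, ℝ))).topologicalClosure := htop ▸ Algebra.mem_top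
  exact closure_minimal hle (Submodule.isClosed_topologicalClosure _) hu

/- `L` separates the points of the quotient of `D` by its fibres, and `G` factors through it. -/
theorem exists_sum_ridge_close (L : V →ₗ[ℝ] C(D, ℝ)) (G : C(D, ℝ))
    (hG : ∀ x y, (∀ v, L v x = L v y) → G x = G y) {ε : ℝ} (hε : 0 < ε) :
    ∃ (n : ℕ) (v : Fin n → V) (a b : Fin n → ℝ),
      ∀ x, |∑ i, a i * σ (L (v i) x + b i) - G x| < ε := by
  let s : Setoid D := Setoid.ker fun x v => L v x
  have hs {x y : D} (hxy : s x y) (v : V) : L v x = L v y := congrFun hxy v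
  let L' : V →ₗ[ℝ] C(Quotient s, ℝ) :=
    { toFun := fun v =>
        ⟨Quotient.lift (L v) fun _ _ hxy => hs hxy v, (L v).continuous.quotient_lift _⟩
      map_add' := fun v w => by ext x; induction x using Quotient.inductionOn; simp
      map_smul' := fun c v => by ext x; induction x using Quotient.inductionOn; simp }
  let G' : C(Quotient s, ℝ) :=
    ⟨Quotient.lift G fun x y hxy => hG x y (hs hxy), G.continuous.quotient_lift _⟩
  have hsep (x y : Quotient s) : (∀ v, L' v x = L' v y) → x = y :=
    Quotient.inductionOn₂ x y fun x y hxy => Quotient.sound (funext hxy)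
  have hmem : G' ∈ (ridgeSpan σ L').topologicalClosure := by
    rw [closure_ridgeSpan_eq_top hσ hσ_nonpoly hsep]; trivial
  obtain ⟨u, hu, hdist⟩ := Metric.mem_closure_iff.1 hmem ε hε
  obtain ⟨n, v, a, b, hsum⟩ := exists_eq_sum_of_mem_ridgeSpan hu
  refine ⟨n, v, a, b, fun x => ?_⟩
  have hx := (ContinuousMap.dist_lt_iff hε).1 hdist ⟦x⟧
  rwa [dist_comm, Real.dist_eq, hsum] at hx

end Ridge

/-! ### Sums of one-hidden-layer networks over multisets -/

section Neuron

/-- The functions computed by networks with `m` inputs, one hidden layer and a scalar output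
without bias. -/
def neuronSpan (σ : ℝ → ℝ) (m : ℕ) : Submodule ℝ ((Fin m → ℝ) → ℝ) :=
  Submodule.span ℝ (Set.range fun (q : (Fin m → ℝ) × ℝ) y => σ (q.1 ⬝ᵥ y + q.2))

variable {σ : C(ℝ, ℝ)} {m n : ℕ}

theorem continuous_of_mem_neuronSpan {φ : (Fin m → ℝ) → ℝ} (hφ : φ ∈ neuronSpan σ m) :
    Continuous φ := by
  induction hφ using Submodule.span_induction with
  | mem φ h =>
    obtain ⟨q, rfl⟩ := h
    simp only [dotProduct]
    fun_prop
  | zero => exact continuous_zero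
  | add _ _ _ _ h h' => exact h.add h'
  | smul c _ _ h => exact h.const_smul c

section Sums

variable {D : Type*} [TopologicalSpace D]

/-- The linear map that sends a network `φ` to the continuous function `x ↦ ∑ φ y`, the sum running
over the multiset `A x`. -/
def multisetSumMap {A : D → Multiset (Fin m → ℝ)}
    (hA : ∀ φ : (Fin m → ℝ) → ℝ, Continuous φ → Continuous fun x => ((A x).map φ).sum) :
    neuronSpan σ m →ₗ[ℝ] C(D, ℝ) where
  toFun φ := ⟨fun x => ((A x).map φ.1).sum, hA φ (continuous_of_mem_neuronSpan φ.2)⟩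
  map_add' φ ψ := by ext; simp [Multiset.sum_map_add]
  map_smul' c φ := by ext; simp [Multiset.sum_map_mul_left]

end Sums

variable (hσ : ContDiff ℝ (⊤ : ℕ∞) σ) (hσ_nonpoly : ¬ ∃ p : Polynomial ℝ, ∀ t, σ t = p.eval t)

include hσ hσ_nonpoly

/- On a finite set the dense span of the neurons is closed. -/
theorem exists_mem_neuronSpan_eqOn (Q : Finset (Fin m → ℝ)) (g : (Fin m → ℝ) → ℝ) :
    ∃ φ ∈ neuronSpan σ m, Set.EqOn φ g Q := by
  let L : (Fin m → ℝ) →ₗ[ℝ] C(Q, ℝ) :=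
    { toFun := fun w => ⟨fun y => w ⬝ᵥ y.1, continuous_of_discreteTopology⟩
      map_add' := fun _ _ => by ext; simp [add_dotProduct]
      map_smul' := fun _ _ => by ext; simp }
  have hsep (x y : Q) (hxy : ∀ w, L w x = L w y) : x = y := by
    ext i
    simpa [L] using hxy (Pi.single i 1)
  have : FiniteDimensional ℝ C(Q, ℝ) :=
    .of_injective (ContinuousMap.coeFnLinearMap ℝ) DFunLike.coe_injective
  have htop : ridgeSpan σ L = ⊤ := by
    rw [← closure_ridgeSpan_eq_top hσ hσ_nonpoly hsep]
    exact (Submodule.closed_of_finiteDimensional _).submodule_topologicalClosure_eq.symm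
  have hmem : (⟨fun y => g y, continuous_of_discreteTopology⟩ : C(Q, ℝ)) ∈ ridgeSpan σ L :=
    htop ▸ Submodule.mem_top
  obtain ⟨n, w, a, b, hsum⟩ := exists_eq_sum_of_mem_ridgeSpan hmem
  refine ⟨∑ i, a i • fun y => σ (w i ⬝ᵥ y + b i), Submodule.sum_mem _ fun i _ =>
    Submodule.smul_mem _ _ (Submodule.subset_span ⟨(w i, b i), rfl⟩), fun y hy => ?_⟩
  simpa [L] using (hsum ⟨y, hy⟩).symm

open Classical in
theorem eq_of_sum_map_eq_of_mem_neuronSpan {s t : Multiset (Fin m → ℝ)}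
    (hst : ∀ φ ∈ neuronSpan σ m, (s.map φ).sum = (t.map φ).sum) : s = t := by
  ext y
  obtain ⟨φ, hφ, heq⟩ := exists_mem_neuronSpan_eqOn hσ hσ_nonpoly (s + t).toFinset
    fun z => if z = y then 1 else 0
  have hcount {r : Multiset (Fin m → ℝ)} (hr : r ≤ s + t) : (r.map φ).sum = r.count y := by
    rw [Multiset.map_congr rfl fun z hz => heq (by simpa using Multiset.mem_of_le hr hz)]
    simp +contextual [Finset.sum_multiset_map_count]
  have := hst φ hφ
  rw [hcount (Multiset.le_add_right s t), hcount (Multiset.le_add_left t s)] at this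
  exact_mod_cast this

theorem exists_sum_deepSets_close {D : Type*} [TopologicalSpace D] [CompactSpace D]
    {A : D → Multiset (Fin m → ℝ)} {B : D → Multiset (Fin n → ℝ)}
    (hA : ∀ φ : (Fin m → ℝ) → ℝ, Continuous φ → Continuous fun x => ((A x).map φ).sum)
    (hB : ∀ ψ : (Fin n → ℝ) → ℝ, Continuous ψ → Continuous fun x => ((B x).map ψ).sum)
    (G : C(D, ℝ)) (hG : ∀ x y, A x = A y → B x = B y → G x = G y) {ε : ℝ} (hε : 0 < ε) :
    ∃ (N : ℕ) (φ : Fin N → neuronSpan σ m) (ψ : Fin N → neuronSpan σ n) (a b : Fin N → ℝ),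
      ∀ x, |∑ i, a i * σ (((A x).map (φ i).1).sum + ((B x).map (ψ i).1).sum + b i) - G x| < ε := by
  let L := (multisetSumMap (σ := σ) hA).coprod (multisetSumMap (σ := σ) hB)
  have hL (x y : D) (hxy : ∀ v, L v x = L v y) : G x = G y := by
    refine hG x y ?_ ?_
    · refine eq_of_sum_map_eq_of_mem_neuronSpan hσ hσ_nonpoly fun φ hφ => ?_
      simpa [L, multisetSumMap] using hxy (⟨φ, hφ⟩, 0)
    · refine eq_of_sum_map_eq_of_mem_neuronSpan hσ hσ_nonpoly fun ψ hψ => ?_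
      simpa [L, multisetSumMap] using hxy (0, ⟨ψ, hψ⟩)
  obtain ⟨N, v, a, b, hclose⟩ := exists_sum_ridge_close hσ hσ_nonpoly L G hL hε
  exact ⟨N, fun i => (v i).1, fun i => (v i).2, a, b, hclose⟩

end Neuron

/-! ### Realization by encoders and networks -/

section Realization

theorem append_dotProduct_append {m n : ℕ} (a c : Fin m → ℝ) (b d : Fin n → ℝ) :
    Fin.append a b ⬝ᵥ Fin.append c d = a ⬝ᵥ c + b ⬝ᵥ d := by
  simp [dotProduct, Fin.sum_univ_add]

open Classical in
theorem exists_mlp_of_mem_neuronSpan {σ : ℝ → ℝ} {m n : ℕ} (e : ℕ) (φ : Fin n → neuronSpan σ m) :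
    ∃ M : MLP (m + e) n, ∀ (y : Fin m → ℝ) (y' : Fin e → ℝ) (i : Fin n),
      M.eval σ (Fin.append y y') i = (φ i).1 y := by
  choose c hc using fun i => Finsupp.mem_span_range_iff_exists_finsupp.1 (φ i).2
  let T : Finset ((Fin m → ℝ) × ℝ) := Finset.univ.biUnion fun i => (c i).support
  let q : Fin T.card → (Fin m → ℝ) × ℝ := fun t => (T.equivFin.symm t).1
  refine ⟨.hidden (Matrix.of fun t => Fin.append (q t).1 0) (fun t => (q t).2)
    (.output (Matrix.of fun i t => c i (q t)) 0), fun y y' i => ?_⟩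
  have hsupp : (c i).support ⊆ T :=
    Finset.subset_biUnion_of_mem (fun i => (c i).support) (Finset.mem_univ i)
  rw [← hc i, Finsupp.sum_of_support_subset _ hsupp _ (by simp), Finset.sum_apply]
  simp only [MLP.eval, Matrix.mulVec, Matrix.of_apply, Pi.add_apply, append_dotProduct_append,
    zero_dotProduct, add_zero, Pi.zero_apply, Pi.smul_apply, smul_eq_mul]
  rw [dotProduct, ← Finset.sum_coe_sort T, ← T.equivFin.symm.sum_comp]

variable {K : ℕ}

/-- The inputs of the diagonal DeepSet for the pair `(j, k)`, without the additional features. -/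
def diagBase (q : Fin K × ChoiceInput K) (k : Fin K) : Fin 5 → ℝ :=
  ![q.2.1 q.1, q.2.1 k, q.2.2 q.1 q.1, q.2.2 k k, q.2.2 q.1 k]

/-- The input of the off-diagonal DeepSet at a position, without the additional features. -/
def offBase (q : Fin K × ChoiceInput K) (p : Fin K × Fin K) : Fin 1 → ℝ :=
  ![q.2.2 p.1 p.2]

/-- The multiset that the diagonal DeepSet of alternative `j` sees of the input `x`; the pair is
`(j, x)`. -/
def diagData (q : Fin K × ChoiceInput K) : Multiset (Fin 5 → ℝ) :=
  (Finset.univ.filter fun k => k ≠ q.1).val.map (diagBase q)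

/-- The multiset that the off-diagonal DeepSet of alternative `j` sees of the input `x`; the pair is
`(j, x)`. -/
def offData (q : Fin K × ChoiceInput K) : Multiset (Fin 1 → ℝ) :=
  (offPositions q.1).val.map (offBase q)

theorem sum_map_diagData (φ : (Fin 5 → ℝ) → ℝ) (q : Fin K × ChoiceInput K) :
    ((diagData q).map φ).sum = ∑ k ∈ Finset.univ.filter (fun k => k ≠ q.1), φ (diagBase q k) := by
  rw [diagData, Multiset.map_map]
  rfl

theorem sum_map_offData (ψ : (Fin 1 → ℝ) → ℝ) (q : Fin K × ChoiceInput K) :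
    ((offData q).map ψ).sum = ∑ p ∈ offPositions q.1, ψ (offBase q p) := by
  rw [offData, Multiset.map_map]
  rfl

theorem continuous_sum_map_diagData {φ : (Fin 5 → ℝ) → ℝ} (hφ : Continuous φ) :
    Continuous fun q : Fin K × ChoiceInput K => ((diagData q).map φ).sum := by
  refine continuous_prod_of_discrete_left.2 fun j => ?_
  simp only [sum_map_diagData]
  exact continuous_finsetSum _ fun k _ => hφ.comp (by simp only [diagBase]; fun_prop)

theorem continuous_sum_map_offData {ψ : (Fin 1 → ℝ) → ℝ} (hψ : Continuous ψ) :
    Continuous fun q : Fin K × ChoiceInput K => ((offData q).map ψ).sum := by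
  refine continuous_prod_of_discrete_left.2 fun j => ?_
  simp only [sum_map_offData]
  exact continuous_finsetSum _ fun p _ => hψ.comp (by simp only [offBase]; fun_prop)

theorem exists_encoder_eval_eq {d n : ℕ} {σ : ℝ → ℝ} (F : ExtraFeatures K)
    (φ : Fin n → neuronSpan σ 5) (ψ : Fin n → neuronSpan σ 1) (ζ : MLP (n + n + F.dPass) d) :
    ∃ E : Encoder F d, ∀ q : Fin K × ChoiceInput K, E.eval σ q.1 q.2 =
      ζ.eval σ (Fin.append (Fin.append (fun i => ((diagData q).map (φ i).1).sum)
        (fun i => ((offData q).map (ψ i).1).sum)) (F.pass q.1 q.2)) := by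
  obtain ⟨M, hM⟩ := exists_mlp_of_mem_neuronSpan F.dDiag φ
  obtain ⟨M', hM'⟩ := exists_mlp_of_mem_neuronSpan F.dOff ψ
  refine ⟨⟨n, n, n, n, M, .output 1 0, M', .output 1 0, ζ⟩, fun q => ?_⟩
  have hdiag (k : Fin K) : M.eval σ (F.diagInput q.2 q.1 k) = fun i => (φ i).1 (diagBase q k) :=
    funext fun i => hM _ _ i
  have hoff (p : Fin K × Fin K) :
      M'.eval σ (F.offInput q.2 p.1 p.2) = fun i => (ψ i).1 (offBase q p) :=
    funext fun i => hM' _ _ i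
  simp only [Encoder.eval, Encoder.hDiag, Encoder.hOff, MLP.eval, Matrix.one_mulVec, add_zero,
    hdiag, hoff]
  congr 3 <;> ext i <;> simp [sum_map_diagData, sum_map_offData]

variable {σ : C(ℝ, ℝ)} (hσ : ContDiff ℝ (⊤ : ℕ∞) σ)
  (hσ_nonpoly : ¬ ∃ p : Polynomial ℝ, ∀ t, σ t = p.eval t) (F : ExtraFeatures K)
  {S : Set (Fin K × ChoiceInput K)} (hS : IsCompact S)
  {G : Fin K × ChoiceInput K → ℝ} (hGc : ContinuousOn G S)
  (hG : ∀ q ∈ S, ∀ q' ∈ S, diagData q = diagData q' → offData q = offData q' → G q = G q')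

include hσ hσ_nonpoly hS hGc hG

theorem exists_sum_data_close {ε : ℝ} (hε : 0 < ε) :
    ∃ (n : ℕ) (φ : Fin n → neuronSpan σ 5) (ψ : Fin n → neuronSpan σ 1) (a b : Fin n → ℝ),
      ∀ q ∈ S, |∑ i, a i * σ (((diagData q).map (φ i).1).sum + ((offData q).map (ψ i).1).sum + b i)
        - G q| < ε := by
  have : CompactSpace S := isCompact_iff_compactSpace.1 hS
  obtain ⟨n, φ, ψ, a, b, hclose⟩ := exists_sum_deepSets_close hσ hσ_nonpoly
    (A := fun q : S => diagData q.1) (B := fun q : S => offData q.1)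
    (fun _ hφ => (continuous_sum_map_diagData hφ).comp continuous_subtype_val)
    (fun _ hψ => (continuous_sum_map_offData hψ).comp continuous_subtype_val)
    ⟨S.domRestrict G, hGc.domRestrict⟩ (fun q q' => hG q q.2 q' q'.2) hε
  exact ⟨n, φ, ψ, a, b, fun q hq => hclose ⟨q, hq⟩⟩

theorem exists_encoder_close {ε : ℝ} (hε : 0 < ε) :
    ∃ E : Encoder F 1, ∀ q ∈ S, |E.eval σ q.1 q.2 0 - G q| < ε := by
  obtain ⟨n, φ, ψ, a, b, hclose⟩ := exists_sum_data_close hσ hσ_nonpoly hS hGc hG hε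
  let w (i : Fin n) : Fin (n + n) → ℝ := Fin.append (Pi.single i 1) (Pi.single i 1)
  let head : neuronSpan σ (n + n) := ⟨∑ i, a i • fun y => σ (w i ⬝ᵥ y + b i),
    Submodule.sum_mem _ fun i _ => Submodule.smul_mem _ _ (Submodule.subset_span ⟨(w i, b i), rfl⟩)⟩
  obtain ⟨ζ, hζ⟩ := exists_mlp_of_mem_neuronSpan (n := 1) F.dPass fun _ => head
  obtain ⟨E, hE⟩ := exists_encoder_eval_eq F φ ψ ζ
  refine ⟨E, fun q hq => ?_⟩
  rw [hE, hζ]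
  simpa [head, w, append_dotProduct_append] using hclose q hq

theorem exists_network_logit_close {ε : ℝ} (hε : 0 < ε) :
    ∃ N : Network F, ∀ q ∈ S, |N.logit σ q.2 q.1 - G q| < ε := by
  obtain ⟨n, φ, ψ, a, b, hclose⟩ := exists_sum_data_close hσ hσ_nonpoly hS hGc hG hε
  let w (i : Fin n) : Fin (n + n) → ℝ := Fin.append (Pi.single i 1) (Pi.single i 1)
  obtain ⟨E, hE⟩ := exists_encoder_eval_eq F φ ψ
    (.output (Matrix.of fun i => Fin.append (w i) (0 : Fin F.dPass → ℝ)) 0)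
  let N : Network F := ⟨n, n, E, .single ⟨1, 0, b⟩, a⟩
  have hlogit (j : Fin K) (x : ChoiceInput K) : N.logit σ x j =
      ∑ i, a i * σ (w i ⬝ᵥ Fin.append (fun i => ((diagData (j, x)).map (φ i).1).sum)
        (fun i => ((offData (j, x)).map (ψ i).1).sum) + b i) := by
    simp [N, Network.logit, EquivariantStack.eval, EquivariantLayer.eval, hE (_, x), MLP.eval,
      Matrix.mulVec, append_dotProduct_append, dotProduct_comm _ a, dotProduct.eq_1 a]
  refine ⟨N, fun q hq => ?_⟩
  rw [hlogit]
  simpa [w, append_dotProduct_append] using hclose q hq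

end Realization

/-! ### The symmetric square root -/

section ScaleSqrt

open scoped MatrixOrder

variable {K : ℕ} {S : Matrix (Fin K) (Fin K) ℝ}

theorem posSemidef_scaleSqrt (S : Matrix (Fin K) (Fin K) ℝ) : (scaleSqrt S).PosSemidef :=
  Matrix.nonneg_iff_posSemidef.1 (CFC.sqrt_nonneg S)

theorem scaleSqrt_mul_self (hS : S.PosSemidef) : scaleSqrt S * scaleSqrt S = S :=
  CFC.sqrt_mul_sqrt_self S (Matrix.nonneg_iff_posSemidef.2 hS)

theorem scaleSqrt_eq_of_mul_self_eq {A : Matrix (Fin K) (Fin K) ℝ} (hA : A.PosSemidef)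
    (h : A * A = S) : scaleSqrt S = A :=
  CFC.sqrt_unique h (Matrix.nonneg_iff_posSemidef.2 hA)

theorem scaleSqrt_submatrix (hS : S.PosSemidef) (π : Equiv.Perm (Fin K)) :
    scaleSqrt (S.submatrix π π) = (scaleSqrt S).submatrix π π := by
  refine scaleSqrt_eq_of_mul_self_eq ((posSemidef_scaleSqrt S).submatrix π) ?_
  rw [Matrix.submatrix_mul_equiv, scaleSqrt_mul_self hS]

theorem dotProduct_scaleSqrt (hS : S.PosSemidef) (i j : Fin K) :
    scaleSqrt S i ⬝ᵥ scaleSqrt S j = S i j := by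
  have hcol : scaleSqrt S j = fun l => scaleSqrt S l j :=
    funext fun l => by simpa using (posSemidef_scaleSqrt S).1.apply l j
  conv_rhs => rw [← scaleSqrt_mul_self hS]
  rw [Matrix.mul_apply, hcol]
  rfl

theorem scaleSqrt_row_eq_iff (hS : S.PosSemidef) (j k : Fin K) :
    scaleSqrt S j = scaleSqrt S k ↔ S j j + S k k - 2 * S j k = 0 := by
  rw [← sub_eq_zero, ← dotProduct_self_eq_zero, sub_dotProduct, dotProduct_sub, dotProduct_sub,
    dotProduct_comm (scaleSqrt S k) (scaleSqrt S j)]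
  simp only [dotProduct_scaleSqrt hS]
  ring_nf

open scoped Matrix.Norms.L2Operator in
theorem continuousOn_scaleSqrt :
    ContinuousOn (scaleSqrt (K := K)) {S | S.PosSemidef} :=
  (CFC.continuousOn_sqrt (A := Matrix (Fin K) (Fin K) ℝ)).mono fun _ hS =>
    Matrix.nonneg_iff_posSemidef.2 hS

end ScaleSqrt

/-! ### Choice probabilities -/

section ChoiceProb

open MeasureTheory Filter
open scoped Topology

theorem ae_linearMap_ne {E : Type*} [NormedAddCommGroup E] [NormedSpace ℝ E] [MeasurableSpace E]
    [BorelSpace E] [FiniteDimensional ℝ E] (μ : Measure E) [μ.IsAddHaarMeasure]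
    {L : E →ₗ[ℝ] ℝ} (hL : L ≠ 0) (t : ℝ) : ∀ᵐ e ∂μ, L e ≠ t :=
  (ae_comp_linearMap_mem_iff L μ volume (L.surjective hL) (measurableSet_singleton t).compl).2
    (Measure.ae_ne volume t)

variable {K : ℕ} {x : ChoiceInput K} {j : Fin K}

/-- The utility `U_k = v_k + (Σ^{1/2} e)_k` of alternative `k`. -/
noncomputable def utility (x : ChoiceInput K) (e : Fin K → ℝ) (k : Fin K) : ℝ :=
  x.1 k + (scaleSqrt x.2).mulVec e k

theorem mem_choiceRegion {e : Fin K → ℝ} :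
    e ∈ choiceRegion j x ↔ ∀ k, k ≠ j → utility x e k ≤ utility x e j := Iff.rfl

theorem continuous_utility (x : ChoiceInput K) (k : Fin K) : Continuous fun e => utility x e k := by
  unfold utility Matrix.mulVec dotProduct
  fun_prop

theorem continuousOn_utility (e : Fin K → ℝ) (k : Fin K) :
    ContinuousOn (fun x => utility x e k) {x | x.2.PosSemidef} := by
  have hsqrt : ContinuousOn (fun x : ChoiceInput K => scaleSqrt x.2) {x | x.2.PosSemidef} :=
    continuousOn_scaleSqrt.comp continuousOn_snd fun _ => id
  have happly : Continuous fun p : ℝ × Matrix (Fin K) (Fin K) ℝ => p.1 + p.2.mulVec e k := by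
    fun_prop
  have hpair : ContinuousOn (fun x : ChoiceInput K => (x.1 k, scaleSqrt x.2))
      {x | x.2.PosSemidef} := by fun_prop
  exact happly.comp_continuousOn hpair

theorem measurableSet_choiceRegion (j : Fin K) (x : ChoiceInput K) :
    MeasurableSet (choiceRegion j x) := by
  simp only [choiceRegion, Set.ofPred_forall]
  exact .iInter fun k => .iInter fun _ =>
    (isClosed_le (continuous_utility x k) (continuous_utility x j)).measurableSet

theorem ae_utility_ne (hx : x.2.PosSemidef) (hties : x ∉ certainTieSet j) :
    ∀ᵐ e, ∀ k, k ≠ j → utility x e k ≠ utility x e j := by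
  refine ae_all_iff.2 fun k => eventually_imp_distrib_left.2 fun hk => ?_
  let L : (Fin K → ℝ) →ₗ[ℝ] ℝ := dotProductBilin ℝ ℝ (scaleSqrt x.2 k - scaleSqrt x.2 j)
  have hsub (e) : utility x e k - utility x e j = x.1 k - x.1 j + L e := by
    simp only [utility, Matrix.mulVec, L, dotProductBilin_apply_apply, sub_dotProduct]
    ring
  by_cases hL : L = 0
  · have hrow : scaleSqrt x.2 j = scaleSqrt x.2 k :=
      (sub_eq_zero.1 (dotProduct_self_eq_zero.1 (LinearMap.congr_fun hL _))).symm
    refine .of_forall fun e he => hties ⟨k, hk, ?_, (scaleSqrt_row_eq_iff hx j k).1 hrow⟩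
    have := hsub e
    rw [hL, he, LinearMap.zero_apply] at this
    linarith
  · filter_upwards [ae_linearMap_ne volume hL (x.1 j - x.1 k)] with e he hU
    have := hsub e
    exact he (by linarith)

theorem eventually_mem_choiceRegion_iff (hx : x.2.PosSemidef) {e : Fin K → ℝ}
    (he : ∀ k, k ≠ j → utility x e k ≠ utility x e j) :
    ∀ᶠ y in 𝓝[{y | y.2.PosSemidef}] x, (e ∈ choiceRegion j y ↔ e ∈ choiceRegion j x) := by
  have hU (k : Fin K) := (continuousOn_utility e k x hx).tendsto
  have hcmp (k : Fin K) : ∀ᶠ y in 𝓝[{y | y.2.PosSemidef}] x,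
      k ≠ j → (utility y e k ≤ utility y e j ↔ utility x e k ≤ utility x e j) := by
    refine eventually_imp_distrib_left.2 fun hk => ?_
    rcases lt_or_gt_of_ne (he k hk) with h | h
    · filter_upwards [(hU k).eventually_lt (hU j) h] with y hy
      exact iff_of_true hy.le h.le
    · filter_upwards [(hU j).eventually_lt (hU k) h] with y hy
      exact iff_of_false hy.not_ge h.not_ge
  filter_upwards [eventually_all.2 hcmp] with y hy
  simp only [mem_choiceRegion]
  exact forall₂_congr hy

variable {f : (Fin K → ℝ) → ℝ}

theorem choiceProb_eq_integral_indicator (f : (Fin K → ℝ) → ℝ) (j : Fin K) (x : ChoiceInput K) :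
    choiceProb f j x = ∫ e, (choiceRegion j x).indicator f e :=
  (integral_indicator (measurableSet_choiceRegion j x)).symm

theorem choiceProb_nonneg (hf : ∀ e, 0 ≤ f e) (j : Fin K) (x : ChoiceInput K) :
    0 ≤ choiceProb f j x :=
  integral_nonneg hf

theorem continuousOn_choiceProb (hf : Integrable f) (j : Fin K) :
    ContinuousOn (choiceProb f j) ({x | x.2.PosSemidef} \ certainTieSet j) := by
  rintro x ⟨hx, hties⟩
  have : FirstCountableTopology (Matrix (Fin K) (Fin K) ℝ) :=
    inferInstanceAs (FirstCountableTopology (Fin K → Fin K → ℝ))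
  rw [funext fun x => choiceProb_eq_integral_indicator f j x]
  refine continuousWithinAt_of_dominated (bound := fun e => ‖f e‖)
    (.of_forall fun y => (hf.indicator (measurableSet_choiceRegion j y)).aestronglyMeasurable)
    (.of_forall fun y => .of_forall fun e => norm_indicator_le_norm_self _ _) hf.norm ?_
  filter_upwards [ae_utility_ne hx hties] with e he
  refine ContinuousWithinAt.mono ?_ Set.sdiff_subset
  refine tendsto_const_nhds.congr' ?_
  filter_upwards [eventually_mem_choiceRegion_iff hx he] with y hy
  exact (Set.indicator_eq_indicator hy rfl).symm

theorem sum_choiceProb [NeZero K] (hf : Integrable f) (hx : x.2.PosSemidef)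
    (hties : ∀ j, x ∉ certainTieSet j) : ∑ j, choiceProb f j x = ∫ e, f e := by
  simp only [choiceProb_eq_integral_indicator]
  rw [← integral_finsetSum _ fun j _ => hf.indicator (measurableSet_choiceRegion j x)]
  refine integral_congr_ae ?_
  filter_upwards [ae_all_iff.2 fun j => ae_utility_ne hx (hties j)] with e he
  obtain ⟨j, hj⟩ := Finite.exists_max (utility x e)
  rw [Finset.sum_eq_single_of_mem j (Finset.mem_univ j) fun i _ hi => ?_]
  · exact Set.indicator_of_mem (mem_choiceRegion.2 fun k _ => hj k) f
  · exact Set.indicator_of_notMem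
      (fun hmem => he j i hi (le_antisymm (hj i) (mem_choiceRegion.1 hmem j hi.symm))) f

/-- The input after relabelling the alternatives: alternative `k` of the new input is
alternative `π k` of the old one. -/
def ChoiceInput.permute (x : ChoiceInput K) (π : Equiv.Perm (Fin K)) : ChoiceInput K :=
  (x.1 ∘ π, x.2.submatrix π π)

theorem utility_permute (hx : x.2.PosSemidef) (π : Equiv.Perm (Fin K)) (e : Fin K → ℝ)
    (k : Fin K) :
    utility (x.permute π) (e ∘ π) k = utility x e (π k) := by
  simp only [utility, ChoiceInput.permute, scaleSqrt_submatrix hx, Matrix.mulVec,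
    Function.comp_apply]
  congr 1
  exact comp_equiv_dotProduct_comp_equiv (scaleSqrt x.2 (π k)) e π

theorem comp_mem_choiceRegion_permute (hx : x.2.PosSemidef) (π : Equiv.Perm (Fin K))
    {e : Fin K → ℝ} :
    e ∘ π ∈ choiceRegion j (x.permute π) ↔ e ∈ choiceRegion (π j) x := by
  simp only [mem_choiceRegion, utility_permute hx]
  rw [← π.forall_congr_right (q := fun k => k ≠ π j → utility x e k ≤ utility x e (π j))]
  simp only [π.injective.ne_iff]

theorem choiceProb_permute (hf : ∀ (π : Equiv.Perm (Fin K)) (e : Fin K → ℝ), f (e ∘ π) = f e)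
    (hx : x.2.PosSemidef) (π : Equiv.Perm (Fin K)) (j : Fin K) :
    choiceProb f j (x.permute π) = choiceProb f (π j) x := by
  let Φ : (Fin K → ℝ) ≃ᵐ (Fin K → ℝ) := MeasurableEquiv.piCongrLeft (fun _ => ℝ) π.symm
  have hΦ (e : Fin K → ℝ) : Φ e = e ∘ π := by
    ext i
    simpa [Φ, MeasurableEquiv.coe_piCongrLeft] using
      Equiv.piCongrLeft_apply_apply (fun _ => ℝ) π.symm e (π i)
  rw [choiceProb, choiceProb, ← (volume_measurePreserving_piCongrLeft (fun _ : Fin K => ℝ)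
    π.symm).setIntegral_preimage_emb Φ.measurableEmbedding]
  have hregion : Φ ⁻¹' choiceRegion j (x.permute π) = choiceRegion (π j) x := by
    ext e
    rw [Set.mem_preimage, hΦ, comp_mem_choiceRegion_permute hx]
  change ∫ e in Φ ⁻¹' _, f (Φ e) = _
  simp only [hregion, hΦ, hf]

end ChoiceProb

/-! ### The data seen by the encoder determine the choice probability -/

section Identification

theorem exists_equiv_of_map_univ_eq {α β γ : Type*} [Fintype α] [Fintype β] {d : α → γ} {d' : β → γ}
    (h : Finset.univ.val.map d = Finset.univ.val.map d') : ∃ e : α ≃ β, ∀ a, d' (e a) = d a := by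
  classical
  have hcard (c : γ) : Fintype.card {a // d a = c} = Fintype.card {b // d' b = c} := by
    simpa only [Multiset.count_map, eq_comm (a := c), ← Finset.filter_val, ← Finset.card_def,
      ← Fintype.card_subtype] using congrArg (Multiset.count c) h
  exact ⟨.ofFiberEquiv fun c => Fintype.equivOfCardEq (hcard c), Equiv.ofFiberEquiv_map _⟩

theorem exists_perm_of_map_val_eq {α γ : Type*} [Finite α] {s s' : Finset α} {d d' : α → γ}
    (h : s.val.map d = s'.val.map d') :
    ∃ π : Equiv.Perm α, (∀ a, π a ∈ s' ↔ a ∈ s) ∧ ∀ a ∈ s, d' (π a) = d a := by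
  classical
  have := Fintype.ofFinite α
  have hattach : Finset.univ.val.map (fun a : s => d a) = Finset.univ.val.map fun a : s' => d' a :=
    (Multiset.attach_map_val' _ d).trans (h.trans (Multiset.attach_map_val' _ d').symm)
  obtain ⟨e, he⟩ := exists_equiv_of_map_univ_eq hattach
  refine ⟨e.extendSubtype, fun a => ⟨not_imp_not.1 (e.extendSubtype_not_mem a),
    e.extendSubtype_mem a⟩, fun a ha => ?_⟩
  rw [e.extendSubtype_apply_of_mem a ha]
  exact he ⟨a, ha⟩

variable {K : ℕ} {j j' k l : Fin K}

/-- The above-diagonal positions outside row and column `j` that hold an entry of row `k` of a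
symmetric matrix. -/
def rowPositions (j k : Fin K) : Finset (Fin K × Fin K) :=
  (offPositions j).filter fun p => p.1 = k ∨ p.2 = k

theorem sum_rowPositions {M : Type*} [AddCommMonoid M] {g : Fin K → Fin K → M}
    (hg : ∀ k l, g k l = g l k) (hk : k ≠ j) :
    ∑ p ∈ rowPositions j k, g p.1 p.2 = ∑ l ∈ (Finset.univ.erase j).erase k, g k l := by
  refine Finset.sum_bij' (fun p _ => if p.1 = k then p.2 else p.1)
    (fun l _ => if k < l then (k, l) else (l, k)) ?_ ?_ ?_ ?_ ?_ <;>
  simp only [rowPositions, offPositions, Finset.mem_filter, Finset.mem_univ, Finset.mem_erase] <;>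
  grind

theorem card_rowPositions (hk : k ≠ j) : (rowPositions j k).card = K - 2 := by
  rw [Finset.card_eq_sum_ones, sum_rowPositions (g := fun _ _ => 1) (fun _ _ => rfl) hk,
    ← Finset.card_eq_sum_ones, Finset.card_erase_of_mem (by simpa using hk),
    Finset.card_erase_of_mem (Finset.mem_univ j), Finset.card_fin, Nat.sub_sub]

theorem exists_mem_rowPositions (hk : k ≠ j) (hl : l ≠ j) (hkl : k ≠ l) :
    ∃ p ∈ offPositions j, p ∈ rowPositions j k ∧ p ∈ rowPositions j l := by
  simp only [rowPositions, offPositions, Finset.mem_filter, Finset.mem_univ, true_and]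
  rcases lt_or_gt_of_ne hkl with h | h
  · exact ⟨(k, l), by grind⟩
  · exact ⟨(l, k), by grind⟩

theorem apply_eq_of_mem_rowPositions {M : Type*} {g : Fin K → Fin K → M}
    (hg : ∀ k l, g k l = g l k) (hkl : k ≠ l) {p : Fin K × Fin K}
    (hpk : p ∈ rowPositions j k) (hpl : p ∈ rowPositions j l) : g p.1 p.2 = g k l := by
  simp only [rowPositions, Finset.mem_filter] at hpk hpl
  grind

variable {x x' : ChoiceInput K}

theorem apply_comm_of_mem_inputSpace (hx : x ∈ inputSpace K) (k l : Fin K) :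
    x.2 k l = x.2 l k := by
  simpa using hx.2.2.2.1.apply l k

theorem sum_row_eq_zero (hx : x ∈ inputSpace K) (k : Fin K) : ∑ l, x.2 k l = 0 := by
  simpa [Matrix.mulVec, dotProduct] using congrFun hx.2.1 k

theorem sum_entries_rowPositions (hx : x ∈ inputSpace K) (hk : k ≠ j) :
    ∑ p ∈ rowPositions j k, x.2 p.1 p.2 = -x.2 k k - x.2 j k := by
  rw [sum_rowPositions (apply_comm_of_mem_inputSpace hx) hk,
    Finset.sum_erase_eq_sub (by simpa using hk), Finset.sum_erase_eq_sub (Finset.mem_univ j),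
    sum_row_eq_zero hx, apply_comm_of_mem_inputSpace hx k j]
  ring

theorem rowPositions_unique (hx : x ∈ inputSpace K) (huniq : UniqueSumsAt j x) (hk : k ≠ j)
    {T : Finset (Fin K × Fin K)} (hT : T ∈ (offPositions j).powersetCard (K - 2))
    (hsum : ∑ p ∈ T, x.2 p.1 p.2 = -x.2 k k - x.2 j k) : T = rowPositions j k :=
  (huniq k hk).unique ⟨hT, hsum⟩ ⟨Finset.mem_powersetCard.2
    ⟨Finset.filter_subset _ _, card_rowPositions hk⟩, sum_entries_rowPositions hx hk⟩

theorem map_rowPositions {τ : Equiv.Perm (Fin K × Fin K)}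
    (hτ : ∀ p, τ p ∈ offPositions j' ↔ p ∈ offPositions j)
    (hentry : ∀ p ∈ offPositions j, x'.2 (τ p).1 (τ p).2 = x.2 p.1 p.2)
    (hx : x ∈ inputSpace K) (hx' : x' ∈ inputSpace K) (huniq : UniqueSumsAt j' x')
    {k' : Fin K} (hk : k ≠ j) (hk' : k' ≠ j')
    (hdiag : x'.2 k' k' = x.2 k k) (hcross : x'.2 j' k' = x.2 j k) :
    (rowPositions j k).map τ.toEmbedding = rowPositions j' k' := by
  have hoff : rowPositions j k ⊆ offPositions j := Finset.filter_subset _ _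
  refine rowPositions_unique hx' huniq hk' (Finset.mem_powersetCard.2 ⟨?_, ?_⟩) ?_
  · intro p' hp'
    obtain ⟨p, hp, rfl⟩ := Finset.mem_map.1 hp'
    exact (hτ p).2 (hoff hp)
  · rw [Finset.card_map, card_rowPositions hk]
  · rw [Finset.sum_map, hdiag, hcross, ← sum_entries_rowPositions hx hk]
    exact Finset.sum_congr rfl fun p hp => hentry p (hoff hp)

theorem apply_eq_of_map_rowPositions {τ : Equiv.Perm (Fin K × Fin K)}
    (hentry : ∀ p ∈ offPositions j, x'.2 (τ p).1 (τ p).2 = x.2 p.1 p.2)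
    (hx : x ∈ inputSpace K) (hx' : x' ∈ inputSpace K) {k' l' : Fin K}
    (hk : k ≠ j) (hl : l ≠ j) (hkl : k ≠ l) (hkl' : k' ≠ l')
    (hmapk : (rowPositions j k).map τ.toEmbedding = rowPositions j' k')
    (hmapl : (rowPositions j l).map τ.toEmbedding = rowPositions j' l') :
    x'.2 k' l' = x.2 k l := by
  obtain ⟨p, hp, hpk, hpl⟩ := exists_mem_rowPositions hk hl hkl
  have hpk' : τ p ∈ rowPositions j' k' := hmapk ▸ Finset.mem_map_of_mem τ.toEmbedding hpk
  have hpl' : τ p ∈ rowPositions j' l' := hmapl ▸ Finset.mem_map_of_mem τ.toEmbedding hpl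
  calc x'.2 k' l' = x'.2 (τ p).1 (τ p).2 :=
        (apply_eq_of_mem_rowPositions (apply_comm_of_mem_inputSpace hx') hkl' hpk' hpl').symm
    _ = x.2 p.1 p.2 := hentry p hp
    _ = x.2 k l := apply_eq_of_mem_rowPositions (apply_comm_of_mem_inputSpace hx) hkl hpk hpl

theorem eq_of_forall_ne_of_sum_eq {ι M : Type*} [Fintype ι] [AddCommGroup M] {u w : ι → M}
    {i : ι} (h : ∀ k, k ≠ i → u k = w k) (hsum : ∑ k, u k = ∑ k, w k) : u = w := by
  classical
  funext k
  obtain rfl | hk := eq_or_ne k i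
  · rw [← Finset.add_sum_erase _ u (Finset.mem_univ k),
      ← Finset.add_sum_erase _ w (Finset.mem_univ k),
      Finset.sum_congr rfl fun l hl => h l (Finset.ne_of_mem_erase hl)] at hsum
    exact add_right_cancel hsum
  · exact h k hk

theorem eq_of_mem_inputSpace_of_forall_ne (hx : x ∈ inputSpace K) (hx' : x' ∈ inputSpace K)
    (hv : ∀ k, k ≠ j → x.1 k = x'.1 k) (hS : ∀ k l, k ≠ j → l ≠ j → x.2 k l = x'.2 k l) :
    x = x' := by
  have hrow (k) (h : ∀ l, l ≠ j → x.2 k l = x'.2 k l) : x.2 k = x'.2 k :=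
    eq_of_forall_ne_of_sum_eq h ((sum_row_eq_zero hx k).trans (sum_row_eq_zero hx' k).symm)
  have hrow_ne (k) (hk : k ≠ j) : x.2 k = x'.2 k := hrow k fun l => hS k l hk
  refine Prod.ext (eq_of_forall_ne_of_sum_eq hv (hx.1.trans hx'.1.symm)) (funext fun k => ?_)
  obtain rfl | hk := eq_or_ne k j
  · refine hrow k fun l hl => ?_
    rw [apply_comm_of_mem_inputSpace hx, hrow_ne l hl, apply_comm_of_mem_inputSpace hx']
  · exact hrow_ne k hk

theorem permute_mem_inputSpace (hx : x ∈ inputSpace K) (π : Equiv.Perm (Fin K)) :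
    x.permute π ∈ inputSpace K := by
  obtain ⟨hv, hrow, htr, hpsd⟩ := hx
  refine ⟨(Equiv.sum_comp π x.1).trans hv, ?_, (Equiv.sum_comp π fun k => x.2 k k).trans htr,
    hpsd.submatrix π⟩
  ext k
  simpa [Matrix.mulVec, dotProduct, ChoiceInput.permute, Equiv.sum_comp π (x.2 (π k))]
    using congrFun hrow (π k)

theorem exists_permute_eq_of_data_eq (hx : x ∈ inputSpace K) (hx' : x' ∈ inputSpace K)
    (huniq : UniqueSumsAt j' x') (hdiag : diagData (j, x) = diagData (j', x'))
    (hoff : offData (j, x) = offData (j', x')) :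
    ∃ π : Equiv.Perm (Fin K), π j = j' ∧ x = x'.permute π := by
  obtain ⟨π, hπ, hbase⟩ := exists_perm_of_map_val_eq hdiag
  obtain ⟨τ, hτ, hentry⟩ := exists_perm_of_map_val_eq hoff
  replace hentry (p) (hp : p ∈ offPositions j) : x'.2 (τ p).1 (τ p).2 = x.2 p.1 p.2 :=
    congrFun (hentry p hp) 0
  simp only [Finset.mem_filter, Finset.mem_univ, true_and] at hπ hbase
  obtain ⟨hv, hvar, hcross⟩ : (∀ k, k ≠ j → x'.1 (π k) = x.1 k) ∧
      (∀ k, k ≠ j → x'.2 (π k) (π k) = x.2 k k) ∧ ∀ k, k ≠ j → x'.2 j' (π k) = x.2 j k := by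
    simp only [diagBase, Matrix.vecCons_inj, and_true] at hbase
    grind
  have hmap (k) (hk : k ≠ j) : (rowPositions j k).map τ.toEmbedding = rowPositions j' (π k) :=
    map_rowPositions hτ hentry hx hx' huniq hk ((hπ k).2 hk) (hvar k hk) (hcross k hk)
  refine ⟨π, not_ne_iff.1 fun h => (hπ j).1 h rfl,
    eq_of_mem_inputSpace_of_forall_ne hx (permute_mem_inputSpace hx' π)
      (fun k hk => (hv k hk).symm) fun k l hk hl => ?_⟩
  obtain rfl | hkl := eq_or_ne k l
  · exact (hvar k hk).symm
  · exact (apply_eq_of_map_rowPositions hentry hx hx' hk hl hkl (π.injective.ne hkl)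
      (hmap k hk) (hmap l hl)).symm

theorem choiceProb_eq_of_data_eq {f : (Fin K → ℝ) → ℝ}
    (hf : ∀ (π : Equiv.Perm (Fin K)) (e : Fin K → ℝ), f (e ∘ π) = f e)
    (hx : x ∈ inputSpace K) (hx' : x' ∈ inputSpace K) (huniq : UniqueSumsAt j' x')
    (hdiag : diagData (j, x) = diagData (j', x')) (hoff : offData (j, x) = offData (j', x')) :
    choiceProb f j x = choiceProb f j' x' := by
  obtain ⟨π, rfl, rfl⟩ := exists_permute_eq_of_data_eq hx hx' huniq hdiag hoff
  exact choiceProb_permute hf hx'.2.2.2 π j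

/- A certain tie makes the rows `j` and `k` of `Σ` equal, so the triples of `j` and `k` coincide for
any third alternative; without a third one the trace vanishes. -/
theorem notMem_certainTieSet (hK : 2 ≤ K) (hx : x ∈ inputSpace K)
    (hdist : ∀ j, DistinctAt j x) (j : Fin K) : x ∉ certainTieSet j := by
  rintro ⟨k, hkj, hv, htie⟩
  have hsymm := apply_comm_of_mem_inputSpace hx
  have hrow (l) : x.2 j l = x.2 k l := by
    rw [← dotProduct_scaleSqrt hx.2.2.2, (scaleSqrt_row_eq_iff hx.2.2.2 j k).2 htie,
      dotProduct_scaleSqrt hx.2.2.2]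
  have hthird (i) (hij : i ≠ j) : i = k := by
    by_contra hik
    refine hkj ((hdist i).1 (Ne.symm hik) hij.symm ?_)
    simp only [Prod.mk.injEq]
    exact ⟨hv.symm, by rw [← hrow k, hsymm, hrow], by rw [hsymm, ← hrow, hsymm]⟩
  have hsum (g : Fin K → ℝ) : ∑ i, g i = g j + g k :=
    Fintype.sum_eq_add j k hkj.symm fun i hi => absurd (hthird i hi.1) hi.2
  have hrow_sum : x.2 j j + x.2 j k = 0 := (hsum _).symm.trans (sum_row_eq_zero hx j)
  have htrace : x.2 j j + x.2 k k = K := (hsum fun i => x.2 i i).symm.trans hx.2.2.1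
  have hK' : (2 : ℝ) ≤ K := mod_cast hK
  linarith [hrow k]

end Identification

/-! ### Softmax -/

section Softmax

variable {ι : Type*} [Fintype ι]

/-- The softmax `exp (L j) / ∑ k, exp (L k)` of a vector of logits. -/
noncomputable def softmax (L : ι → ℝ) (j : ι) : ℝ :=
  Real.exp (L j) / ∑ k, Real.exp (L k)

theorem sum_exp_pos [Nonempty ι] (L : ι → ℝ) : 0 < ∑ k, Real.exp (L k) :=
  Finset.sum_pos (fun _ _ => Real.exp_pos _) Finset.univ_nonempty

theorem softmax_le_one (L : ι → ℝ) (j : ι) : softmax L j ≤ 1 :=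
  div_le_one_of_le₀
    (Finset.single_le_sum (f := fun k => Real.exp (L k)) (fun _ _ => (Real.exp_pos _).le)
      (Finset.mem_univ j))
    (Finset.sum_nonneg fun _ _ => (Real.exp_pos _).le)

theorem softmax_le_exp_mul_softmax {L M : ι → ℝ} {η : ℝ} (h : ∀ i, |L i - M i| ≤ η) (j : ι) :
    softmax L j ≤ Real.exp (2 * η) * softmax M j := by
  have : Nonempty ι := ⟨j⟩
  unfold softmax
  rw [← mul_div_assoc, div_le_div_iff₀ (sum_exp_pos L) (sum_exp_pos M), Finset.mul_sum,
    Finset.mul_sum]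
  refine Finset.sum_le_sum fun k _ => ?_
  simp only [← Real.exp_add]
  refine Real.exp_le_exp.2 ?_
  linarith [(abs_le.1 (h j)).2, (abs_le.1 (h k)).1]

theorem abs_softmax_sub_softmax_le {L M : ι → ℝ} {η : ℝ} (h : ∀ i, |L i - M i| ≤ η) (j : ι) :
    |softmax L j - softmax M j| ≤ Real.exp (2 * η) - 1 := by
  have hη : 0 ≤ Real.exp (2 * η) - 1 := by
    have := (abs_nonneg _).trans (h j)
    linarith [Real.one_le_exp (x := 2 * η) (by linarith)]
  rw [abs_sub_le_iff]
  constructor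
  · linarith [softmax_le_exp_mul_softmax h j, mul_le_of_le_one_right hη (softmax_le_one M j)]
  · have h' (i) : |M i - L i| ≤ η := abs_sub_comm (L i) (M i) ▸ h i
    linarith [softmax_le_exp_mul_softmax h' j, mul_le_of_le_one_right hη (softmax_le_one L j)]

variable {p : ι → ℝ} {δ : ℝ}

theorem softmax_log_add (hp : ∀ i, 0 ≤ p i) (hsum : ∑ i, p i = 1) (hδ : 0 < δ) (j : ι) :
    softmax (fun i => Real.log (p i + δ)) j = (p j + δ) / (1 + Fintype.card ι * δ) := by
  have hexp (i : ι) : Real.exp (Real.log (p i + δ)) = p i + δ :=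
    Real.exp_log (add_pos_of_nonneg_of_pos (hp i) hδ)
  simp only [softmax, hexp, Finset.sum_add_distrib, hsum, Finset.sum_const, Finset.card_univ,
    nsmul_eq_mul]

theorem abs_softmax_log_add_sub_le (hp : ∀ i, 0 ≤ p i) (hsum : ∑ i, p i = 1) (hδ : 0 < δ)
    (j : ι) : |softmax (fun i => Real.log (p i + δ)) j - p j| ≤ Fintype.card ι * δ := by
  have hcard : (1 : ℝ) ≤ Fintype.card ι := mod_cast Fintype.card_pos_iff.2 ⟨j⟩
  have hp1 : p j ≤ 1 := hsum ▸ Finset.single_le_sum (fun i _ => hp i) (Finset.mem_univ j)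
  have hden : 1 ≤ 1 + Fintype.card ι * δ := le_add_of_nonneg_right (by positivity)
  have hden_pos : 0 < 1 + Fintype.card ι * δ := one_pos.trans_le hden
  have hdiff : (p j + δ) / (1 + Fintype.card ι * δ) - p j =
      δ * (1 - Fintype.card ι * p j) / (1 + Fintype.card ι * δ) := by
    field_simp
    ring
  have hnum : |1 - Fintype.card ι * p j| ≤ Fintype.card ι := by
    rw [abs_le]
    constructor <;> nlinarith [hp j]
  rw [softmax_log_add hp hsum hδ, hdiff, abs_div, abs_mul, abs_of_pos hδ,
    abs_of_pos hden_pos, mul_comm δ |_|]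
  exact (div_le_self (by positivity) hden).trans (mul_le_mul_of_nonneg_right hnum hδ.le)

theorem exists_softmax_close_of_log_close (ι : Type*) [Fintype ι] {ε : ℝ} (hε : 0 < ε) :
    ∃ δ > 0, ∃ η > 0, ∀ p L : ι → ℝ, (∀ i, 0 ≤ p i) → ∑ i, p i = 1 →
      (∀ i, |L i - Real.log (p i + δ)| < η) → ∀ j, |softmax L j - p j| < ε := by
  obtain ⟨δ, hδ, hδε⟩ := exists_pos_mul_lt (half_pos hε) (Fintype.card ι)
  have hlim : Filter.Tendsto (fun η => Real.exp (2 * η) - 1) (nhds 0) (nhds 0) := by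
    have hcont : Continuous fun η => Real.exp (2 * η) - 1 := by fun_prop
    simpa using hcont.tendsto 0
  obtain ⟨η, hηε, hη⟩ := ((hlim.eventually_lt_const (half_pos hε)).filter_mono
    nhdsWithin_le_nhds).and self_mem_nhdsWithin |>.exists (f := nhdsWithin 0 (Set.Ioi 0))
  refine ⟨δ, hδ, η, hη, fun p L hp hsum hclose j => ?_⟩
  have hlogits := abs_softmax_sub_softmax_le (fun i => (hclose i).le) j
  have hsmooth := abs_softmax_log_add_sub_le hp hsum hδ j
  calc |softmax L j - p j|
      ≤ |softmax L j - softmax (fun i => Real.log (p i + δ)) j| +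
        |softmax (fun i => Real.log (p i + δ)) j - p j| := abs_sub_le _ _ _
    _ < ε / 2 + ε / 2 := add_lt_add (hlogits.trans_lt hηε) (hsmooth.trans_lt hδε)
    _ = ε := add_halves ε

end Softmax

/-! ### Emulation of the choice probabilities -/

section Emulation

variable {K : ℕ}

/-- The pairs `(j, x)` at which `choiceProb f j x` is continuous in the input `x` and determined by
the data that the encoder of alternative `j` sees: part (b) of the definition of `B_j` holds, and
`j` has no certain tie. -/
def identifiableSet (K : ℕ) : Set (Fin K × ChoiceInput K) :=
  {q | q.2 ∈ inputSpace K ∧ UniqueSumsAt q.1 q.2 ∧ q.2 ∉ certainTieSet q.1}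

theorem continuousOn_choiceProb_identifiableSet {f : (Fin K → ℝ) → ℝ}
    (hf : MeasureTheory.Integrable f) :
    ContinuousOn (fun q : Fin K × ChoiceInput K => choiceProb f q.1 q.2) (identifiableSet K) :=
  continuousOn_prod_of_discrete_left.2 fun j =>
    (continuousOn_choiceProb hf j).mono fun _ hx => ⟨hx.1.2.2.2, hx.2.2⟩

theorem distinctAt_and_uniqueSumsAt {x : ChoiceInput K} {j : Fin K}
    (hx : x ∈ inputSpace K \ exceptionalSet j) : DistinctAt j x ∧ UniqueSumsAt j x :=
  not_not.1 fun h => hx.2 ⟨hx.1, h⟩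

theorem singleton_prod_subset_identifiableSet {j : Fin K} {C : Set (ChoiceInput K)}
    (hC : C ⊆ inputSpace K \ exceptionalSet j) (hties : Disjoint C (certainTieSet j)) :
    {j} ×ˢ C ⊆ identifiableSet K := by
  rintro ⟨_, x⟩ ⟨rfl, hx⟩
  exact ⟨(hC hx).1, (distinctAt_and_uniqueSumsAt (hC hx)).2, Set.disjoint_left.1 hties hx⟩

theorem univ_prod_subset_identifiableSet (hK : 2 ≤ K) {C : Set (ChoiceInput K)}
    (hC : C ⊆ inputSpace K \ ⋃ j, exceptionalSet j) :
    Set.univ ×ˢ C ⊆ identifiableSet K := by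
  rintro ⟨j, x⟩ ⟨-, hx⟩
  have hgood (i) := distinctAt_and_uniqueSumsAt
    ⟨(hC hx).1, fun h => (hC hx).2 (Set.mem_iUnion_of_mem i h)⟩
  exact ⟨(hC hx).1, (hgood j).2, notMem_certainTieSet hK (hC hx).1 (fun i => (hgood i).1) j⟩

theorem corollary1_general (f : (Fin K → ℝ) → ℝ) (hf : IsExchangeableDensity f)
    (σ : ℝ → ℝ) (hσ : ContDiff ℝ (⊤ : ℕ∞) σ)
    (hσ_nonpoly : ¬ ∃ p : Polynomial ℝ, ∀ t, σ t = p.eval t)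
    (F : ExtraFeatures K) :
    (∀ S : Set (Fin K × ChoiceInput K), IsCompact S → S ⊆ identifiableSet K →
      ∀ ε : ℝ, 0 < ε → ∃ E : Encoder F 1, ∀ q ∈ S,
        |E.eval σ q.1 q.2 0 - choiceProb f q.1 q.2| < ε) ∧
    (∀ C : Set (ChoiceInput K), IsCompact C → Set.univ ×ˢ C ⊆ identifiableSet K →
      ∀ ε : ℝ, 0 < ε → ∃ N : Network F, ∀ x ∈ C, ∀ j, |N.prob σ x j - choiceProb f j x| < ε) := by
  lift σ to C(ℝ, ℝ) using hσ.continuous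
  have hcont := continuousOn_choiceProb_identifiableSet hf.integrable
  have hdata : ∀ q ∈ identifiableSet K, ∀ q' ∈ identifiableSet K, diagData q = diagData q' →
      offData q = offData q' → choiceProb f q.1 q.2 = choiceProb f q'.1 q'.2 :=
    fun q hq q' hq' => choiceProb_eq_of_data_eq hf.exchangeable hq.1 hq'.1 hq'.2.1
  refine ⟨fun S hS hsub ε hε => exists_encoder_close hσ hσ_nonpoly F hS (hcont.mono hsub)
    (fun q hq q' hq' => hdata q (hsub hq) q' (hsub hq')) hε, fun C hC hsub ε hε => ?_⟩
  obtain ⟨δ, hδ, η, hη, hsoftmax⟩ := exists_softmax_close_of_log_close (Fin K) hε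
  have hlog : ContinuousOn (fun q : Fin K × ChoiceInput K => Real.log (choiceProb f q.1 q.2 + δ))
      (Set.univ ×ˢ C) :=
    ((hcont.mono hsub).add continuousOn_const).log fun q _ =>
      (add_pos_of_nonneg_of_pos (choiceProb_nonneg hf.nonneg q.1 q.2) hδ).ne'
  obtain ⟨N, hN⟩ := exists_network_logit_close hσ hσ_nonpoly F (isCompact_univ.prod hC) hlog
    (fun q hq q' hq' hd ho => by rw [hdata q (hsub hq) q' (hsub hq') hd ho]) hη
  refine ⟨N, fun x hx j => hsoftmax (choiceProb f · x) (N.logit σ x)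
    (fun i => choiceProb_nonneg hf.nonneg i x) ?_ (fun i => hN (i, x) ⟨trivial, hx⟩) j⟩
  have : NeZero K := ⟨j.pos.ne'⟩
  have hmem (i : Fin K) : (i, x) ∈ identifiableSet K := hsub ⟨trivial, hx⟩
  rw [sum_choiceProb hf.integrable (hmem j).1.2.2.2 fun i => (hmem i).2.2, hf.integral_eq_one]

end Emulation

theorem corollary1 {K : ℕ} (hK : 2 ≤ K)
    (f : (Fin K → ℝ) → ℝ) (hf : IsExchangeableDensity f)
    (σ : ℝ → ℝ) (hσ : ContDiff ℝ (⊤ : ℕ∞) σ)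
    (hσ_nonpoly : ¬ ∃ p : Polynomial ℝ, ∀ t, σ t = p.eval t)
    (F : ExtraFeatures K) :
    (∀ (j : Fin K) (C : Set (ChoiceInput K)), IsCompact C →
      C ⊆ inputSpace K \ exceptionalSet j → Disjoint C (certainTieSet j) →
      ∀ ε : ℝ, 0 < ε → ∃ E : Encoder F 1, ∀ x ∈ C, |E.eval σ j x 0 - choiceProb f j x| < ε) ∧
    (∀ C : Set (ChoiceInput K), IsCompact C →
      C ⊆ inputSpace K \ ⋃ j, exceptionalSet j →
      ∀ ε : ℝ, 0 < ε → ∃ N : Network F, ∀ x ∈ C, ∀ j, |N.prob σ x j - choiceProb f j x| < ε) :=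
  (corollary1_general f hf σ hσ hσ_nonpoly F).imp
    (fun hencoder j C hC hsub hties ε hε =>
      (hencoder ({j} ×ˢ C) (isCompact_singleton.prod hC)
        (singleton_prod_subset_identifiableSet hsub hties) ε hε).imp
        fun _ hE x hx => hE (j, x) ⟨rfl, hx⟩)
    fun hnetwork C hC hsub => hnetwork C hC (univ_prod_subset_identifiableSet hK hsub)
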